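/- Let $G$ be a finite simple graph and $r\ge 3$ an integer. For a vertex $v$ of $G$, the ball $B_{r/2}(v)$ is the subgraph of $G$ consisting of all vertices at distance at most $r/2$ from $v$ and all edges $xy$ of $G$ with $d_G(v,x)+d_G(v,y)<r$. Suppose that $G$ is $r$-locally chordal, i.e. every ball $B_{r/2}(v)$ is chordal (each of its cycles of length at least four has a chord). Let $K(G)$ be the set of inclusion-wise maximal cliques of $G$, let $K_G(v)$ be the set of those containing the vertex $v$, and let $\mathbf K(G)$ be the graph with vertex set $K(G)$ in which distinct $K_1,K_2$ are adjacent if $K_1\cap K_2\neq\emptyset$; the edge $K_1K_2$ has weight $|K_1\cap K_2|$, and the weight of a subgraph of $\mathbf K(G)$ is the sum of the weights of its edges. For a spanning subgraph $H$ of $\mathbf K(G)$ put $H_v:=H[K_G(v)]$ for $v\in V(G)$. For an integer $s \ge 0$, call $H$ $s$-acyclic if for every set $X$ of at most $s$ vertices of $G$ the union $\bigcup_{v\in X}H_v$ contains no cycle. Call $H$ a clique graph of $G$ if $v\mapsto H_v$ is a region representation of $G$ over $H$, i.e. every $H_v$ is nonempty and connected, and any two distinct vertices $u,v$ are adjacent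 in $G$ if and only if $H_u$ and $H_v$ have a common vertex. Then for every subgraph $H$ of $\mathbf K(G)$ the following are equivalent: 1. $H$ is a spanning subgraph of $\mathbf K(G)$ that is an $r$-acyclic clique graph of $G$. 2. $H$ is a $2$-acyclic spanning subgraph of $\mathbf K(G)$ whose weight is maximum among all $2$-acyclic spanning subgraphs of $\mathbf K(G)$. 3. $H$ is a $2$-acyclic spanning subgraph of $\mathbf K(G)$ of weight $\left(\sum_{K\in K(G)}|K|\right)-|V(G)|$. -/

import Mathlib

namespace LocChordal

open SimpleGraph

/-- A graph is chordal if every cycle of length at least four has a chord: an edge of the graph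
between two vertices of the cycle which is not an edge of the cycle. -/
def IsChordal {V : Type*} (G : SimpleGraph V) : Prop :=
  ∀ (v : V) (c : G.Walk v v), c.IsCycle → 4 ≤ c.length →
    ∃ x ∈ c.support, ∃ y ∈ c.support, G.Adj x y ∧ s(x, y) ∉ c.edges

/-- The ball of radius `r / 2` around `v`: the vertices at distance at most `r / 2` from `v`, with
those edges of `G` for which the sum of the distances of the two ends to `v` is less than `r`.
Distances are extended distances, so that vertices in other components are at distance `⊤`. -/
def halfBall {V : Type*} (G : SimpleGraph V) (v : V) (r : ℕ) : G.Subgraph where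
  verts := {u | 2 * G.edist v u ≤ (r : ℕ∞)}
  Adj a b := G.Adj a b ∧ G.edist v a + G.edist v b < (r : ℕ∞)
  adj_sub h := h.1
  edge_vert := by
    rintro a b ⟨hab, hlt⟩
    have h1 : G.edist v a ≤ G.edist v b + 1 :=
      (SimpleGraph.edist_triangle (v := b)).trans
        (add_le_add le_rfl (G.edist_le_one_iff_adj_or_eq.2 (Or.inl hab.symm)))
    have h2 : 2 * G.edist v a ≤ G.edist v a + G.edist v b + 1 := by
      rw [two_mul, add_assoc]
      exact add_le_add le_rfl h1
    exact h2.trans (Order.add_one_le_of_lt hlt)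
  symm := ⟨fun a b h => ⟨h.1.symm, by rw [add_comm]; exact h.2⟩⟩

/-- A graph is `r`-locally chordal if all its balls of radius `r / 2` are chordal. -/
def IsLocallyChordal {V : Type*} (G : SimpleGraph V) (r : ℕ) : Prop :=
  ∀ v : V, IsChordal (halfBall G v r).coe

/-- The type of all inclusion-wise maximal cliques of `G`. -/
abbrev MaxClique {V : Type*} (G : SimpleGraph V) : Type _ :=
  {K : Set V // Maximal G.IsClique K}

/-- The intersection graph of the maximal cliques of `G`. -/
def cliqueIntersectionGraph {V : Type*} (G : SimpleGraph V) : SimpleGraph (MaxClique G) where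
  Adj K L := K ≠ L ∧ (K.1 ∩ L.1).Nonempty
  symm := ⟨fun K L h => ⟨h.1.symm, by rw [Set.inter_comm]; exact h.2⟩⟩
  loopless := ⟨fun _ h => h.1 rfl⟩

/-- The set of all maximal cliques of `G` that contain `v`. -/
def cliquesThrough {V : Type*} (G : SimpleGraph V) (v : V) : Set (MaxClique G) :=
  {K | v ∈ K.1}

/-- For a spanning subgraph `H` of the intersection graph of the maximal cliques, the subgraph of
`H` induced on the set of all maximal cliques containing `v`. -/
def coPart {V : Type*} (G : SimpleGraph V) (H : (cliqueIntersectionGraph G).Subgraph) (v : V) :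
    (cliqueIntersectionGraph G).Subgraph :=
  H.induce (cliquesThrough G v)

/-- A family of subgraphs is `r`-acyclic if every union of at most `r` of its members is acyclic. -/
def IsAcyclicFamily {V W : Type*} {Γ : SimpleGraph W} (F : V → Γ.Subgraph) (r : ℕ) : Prop :=
  ∀ X : Finset V, X.card ≤ r → (⨆ v ∈ X, F v).coe.IsAcyclic

/-- The map `v ↦ F v` is a region representation of `G` over the subgraph `H` of `Γ`: every `F v`
is a (nonempty) connected subgraph of `H`, and two distinct vertices are adjacent in `G` exactly
when their regions share a vertex. -/
structure IsRegionRepresentation {V W : Type*} (G : SimpleGraph V) {Γ : SimpleGraph W}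
    (H : Γ.Subgraph) (F : V → Γ.Subgraph) : Prop where
  le : ∀ v, F v ≤ H
  connected : ∀ v, (F v).Connected
  adj_iff : ∀ u v, u ≠ v → (G.Adj u v ↔ ((F u).verts ∩ (F v).verts).Nonempty)

/-- A clique graph of `G` is a spanning subgraph `H` of the intersection graph of the maximal
cliques for which the induced subgraphs on the maximal cliques through the single vertices form a
region representation of `G` over `H`. -/
def IsCliqueGraph {V : Type*} (G : SimpleGraph V)
    (H : (cliqueIntersectionGraph G).Subgraph) : Prop :=
  H.IsSpanning ∧ IsRegionRepresentation G H (coPart G H)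

/-- A clique graph whose corresponding region representation is `r`-acyclic. -/
def IsAcyclicCliqueGraph {V : Type*} (G : SimpleGraph V) (r : ℕ)
    (H : (cliqueIntersectionGraph G).Subgraph) : Prop :=
  IsCliqueGraph G H ∧ IsAcyclicFamily (coPart G H) r

/-- An `r`-acyclic spanning subgraph of the intersection graph of the maximal cliques. -/
def IsAcyclicSpanning {V : Type*} (G : SimpleGraph V) (r : ℕ)
    (H : (cliqueIntersectionGraph G).Subgraph) : Prop :=
  H.IsSpanning ∧ IsAcyclicFamily (coPart G H) r

/-- The weight `|K ∩ L|` of an edge `KL` of the intersection graph of the maximal cliques. -/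
noncomputable def edgeWeight {V : Type*} (G : SimpleGraph V) : Sym2 (MaxClique G) → ℕ :=
  Sym2.lift ⟨fun K L => (K.1 ∩ L.1).ncard, fun K L => congrArg Set.ncard (Set.inter_comm K.1 L.1)⟩

/-- The total weight of a subgraph, used for finite `G`: the sum of the weights of its edges. -/
noncomputable def totalWeight {V : Type*} (G : SimpleGraph V)
    (H : (cliqueIntersectionGraph G).Subgraph) : ℕ :=
  ∑ᶠ e ∈ H.edgeSet, edgeWeight G e

/-- An `r`-acyclic spanning subgraph that has maximum total weight among all `r`-acyclic spanning
subgraphs of the intersection graph of the maximal cliques. -/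
def IsMaxWeightAcyclicSpanning {V : Type*} (G : SimpleGraph V) (r : ℕ)
    (H : (cliqueIntersectionGraph G).Subgraph) : Prop :=
  IsAcyclicSpanning G r H ∧
    ∀ H' : (cliqueIntersectionGraph G).Subgraph,
      IsAcyclicSpanning G r H' → totalWeight G H' ≤ totalWeight G H

end LocChordal

/-!
A vertex elimination ordering of a chordal graph yields a forest on any system of bags (cliques
covering all cliques) in which the bags containing a given vertex form a subtree. For `r ≥ 3` the
closed neighbourhood of every vertex `v` is chordal, which gives such a tree on the maximal cliques
through `v`. Choosing each of these trees minimal for an injective additive weight makes them agree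
on the cliques common to two vertices, so that they glue to one graph `H`. Conversely, 2-acyclicity
and connectedness of all `H_v` imply that the intersections `H_u ∩ H_v` are subtrees.

A set `X` of at most `r` vertices induces a chordal graph. Eliminating its vertices one at a time,
`H_x` meets the union of the regions of the remaining vertices in subtrees `H_x ∩ H_y` sharing a
maximal clique that contains `x` and its remaining neighbours, so the union stays acyclic.

Finally, `w(H) = ∑ v, |E(H_v)|`. If all `H_v` are acyclic, this is at most
`∑ v, (|K_G(v)| - 1) = ∑ K, |K| - |V(G)|`, with equality iff every `H_v` is connected.
-/

namespace LocChordal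

open SimpleGraph

variable {V W ι : Type*}

section Induce

variable {G G' : SimpleGraph V} {s t : Set V} {a b : V}

theorem spanningCoe_induce_adj :
    (G.induce s).spanningCoe.Adj a b ↔ G.Adj a b ∧ a ∈ s ∧ b ∈ s := by
  simp [map_adj, and_comm, and_assoc, and_left_comm]

theorem support_spanningCoe_induce_subset : (G.induce s).spanningCoe.support ⊆ s :=
  fun _ ⟨_, h⟩ => (spanningCoe_induce_adj.1 h).2.1

theorem reachable_induce_mono (hst : s ⊆ t) (hle : (G.induce s).spanningCoe ≤ G') {ha : a ∈ s}
    {hb : b ∈ s} (h : (G.induce s).Reachable ⟨a, ha⟩ ⟨b, hb⟩) :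
    (G'.induce t).Reachable ⟨a, hst ha⟩ ⟨b, hst hb⟩ :=
  h.map ⟨Set.inclusion hst, fun {x y} hxy => hle (spanningCoe_induce_adj.2 ⟨hxy, x.2, y.2⟩)⟩

theorem preconnected_of_forall_adj_reachable (hG : G.Preconnected)
    (h : ∀ a b, G.Adj a b → G'.Reachable a b) : G'.Preconnected := by
  intro a b
  obtain ⟨p⟩ := hG a b
  induction p with
  | nil => exact Reachable.refl _
  | cons hadj _ ih => exact (h _ _ hadj).trans ih

theorem reachable_spanningCoe_induce (h : (G.induce s).Preconnected) (ha : a ∈ s) (hb : b ∈ s) :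
    (G.induce s).spanningCoe.Reachable a b :=
  (h ⟨a, ha⟩ ⟨b, hb⟩).map (Embedding.spanningCoe _).toHom

theorem preconnected_induce_inter (hG : G.IsAcyclic) (hs : (G.induce s).Preconnected)
    (ht : (G.induce t).Preconnected) : (G.induce (s ∩ t)).Preconnected := by
  classical
  rintro ⟨a, has, hat⟩ ⟨b, hbs, hbt⟩
  obtain ⟨p, hp⟩ := (hs ⟨a, has⟩ ⟨b, hbs⟩).exists_isPath
  obtain ⟨q, hq⟩ := (ht ⟨a, hat⟩ ⟨b, hbt⟩).exists_isPath
  have hpq : p.map (Embedding.induce s).toHom = q.map (Embedding.induce t).toHom :=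
    congrArg Subtype.val ((hG.subsingleton_path a b).elim
      ⟨_, hp.map Subtype.val_injective⟩ ⟨_, hq.map Subtype.val_injective⟩)
  have hmem : ∀ x ∈ (p.map (Embedding.induce s).toHom).support, x ∈ s ∩ t := by
    refine fun x hx => ⟨?_, ?_⟩
    · obtain ⟨y, -, rfl⟩ := List.mem_map.1 (Walk.support_map _ p ▸ hx)
      exact y.2
    · obtain ⟨y, -, rfl⟩ := List.mem_map.1 (Walk.support_map _ q ▸ hpq ▸ hx)
      exact y.2
  exact (Walk.induce _ _ hmem).reachable

end Induce

section AcyclicSup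

variable {A B D : SimpleGraph W}

theorem reachable_of_reachable_sup {S : Set W} (hB : B.support ⊆ S)
    (h : ∀ s ∈ A.support ∩ S, ∀ t ∈ A.support ∩ S, B.Reachable s t) {x y : W} (hx : x ∈ S)
    (hy : y ∈ S) (hxy : (A ⊔ B).Reachable x y) : B.Reachable x y := by
  obtain ⟨p⟩ := hxy
  -- Outside `S` the walk runs in `A`; it may then be restarted from any vertex of `A` in `S`.
  suffices key : (x ∈ S → B.Reachable x y) ∧
      (x ∈ A.support → ∀ s ∈ A.support ∩ S, B.Reachable s y) from key.1 hx
  clear hx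
  induction p with
  | nil => exact ⟨fun _ => Reachable.refl _, fun hA s hs => h s hs _ ⟨hA, hy⟩⟩
  | cons hadj _ ih =>
    specialize ih hy
    rcases hadj with hadj | hadj
    · have hstep := ih.2 ⟨_, hadj.symm⟩
      exact ⟨fun hS => hstep _ ⟨⟨_, hadj⟩, hS⟩, fun _ => hstep⟩
    · have hstep := hadj.reachable.trans (ih.1 (hB ⟨_, hadj.symm⟩))
      exact ⟨fun _ => hstep, fun hA s hs => (h s hs _ ⟨hA, hB ⟨_, hadj⟩⟩).trans hstep⟩

theorem isAcyclic_sup_sdiff (hA : A.IsAcyclic) (hB : B.IsAcyclic) (hD : D ≤ B)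
    (h : ∀ s ∈ A.support ∩ B.support, ∀ t ∈ A.support ∩ B.support, D.Reachable s t) :
    (A ⊔ B \ D).IsAcyclic := by
  have isBridge : ∀ x y, (B \ D).Adj x y → (A ⊔ B \ D).IsBridge s(x, y) := by
    intro x y hxy hr
    have hle : D ≤ B.deleteEdges {s(x, y)} := fun a b hab => by
      rw [deleteEdges_adj]
      refine ⟨hD hab, fun he => hxy.2 ?_⟩
      rwa [← mem_edgeSet, ← Set.mem_singleton_iff.1 he]
    refine isAcyclic_iff_forall_adj_isBridge.1 hB hxy.1
      (reachable_of_reachable_sup (A := A) (support_mono (deleteEdges_le _))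
        (fun s hs t ht => (h s hs t ht).mono hle) ⟨y, hxy.1⟩ ⟨x, hxy.1.symm⟩ (hr.mono ?_))
    intro a b hab
    rw [deleteEdges_adj] at hab
    exact hab.1.imp id fun hab' => (deleteEdges_adj ..).2 ⟨hab'.1, hab.2⟩
  intro v c hc
  have hcA : ∀ e ∈ c.edges, e ∈ A.edgeSet := by
    intro e he
    induction e with
    | h x y =>
      rcases c.adj_of_mem_edges he with hxy | hxy
      · exact hxy
      · exact absurd he ((isBridge x y hxy).notMem_edges_of_isCycle hc)
  exact hA _ (hc.transfer hcA)

theorem isAcyclic_sup (hA : A.IsAcyclic) (hB : B.IsAcyclic)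
    (h : ∀ s ∈ A.support ∩ B.support, ∀ t ∈ A.support ∩ B.support, (A ⊓ B).Reachable s t) :
    (A ⊔ B).IsAcyclic := by
  simpa only [sdiff_inf_self_right, sup_sdiff_self] using
    isAcyclic_sup_sdiff hA hB inf_le_right h

end AcyclicSup

section Chordless

variable {G : SimpleGraph V} {G' : SimpleGraph W}

theorem isChordal_iff_not_isChordless :
    IsChordal G ↔ ∀ (v : V) (c : G.Walk v v), c.IsCycle → 4 ≤ c.length → ¬ c.IsChordless := by
  simp only [IsChordal, Walk.isChordless_iff_forall_mem_edges]
  push Not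
  simp only [exists_and_left]

theorem isChordless_of_map {f : G →g G'} (hf : Function.Injective f) {a b : V} {p : G.Walk a b}
    (hp : (p.map f).IsChordless) : p.IsChordless := by
  rw [Walk.isChordless_iff_forall_mem_edges]
  intro x y hx hy hxy
  have hmem : s(f x, f y) ∈ (p.map f).edges :=
    hp.mem_edges (Walk.support_map f p ▸ List.mem_map_of_mem hx)
      (Walk.support_map f p ▸ List.mem_map_of_mem hy) (f.map_adj hxy)
  rw [Walk.edges_map, ← Sym2.map_mk] at hmem
  exact (List.mem_map_of_injective (Sym2.map.injective hf)).1 hmem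

theorem isChordless_map (f : G ↪g G') {a b : V} {p : G.Walk a b} (hp : p.IsChordless) :
    (p.map f.toHom).IsChordless := by
  rw [Walk.isChordless_iff_forall_mem_edges]
  intro x y hx hy hxy
  rw [Walk.support_map, List.mem_map] at hx hy
  obtain ⟨x, hx, rfl⟩ := hx
  obtain ⟨y, hy, rfl⟩ := hy
  rw [Walk.edges_map, ← Sym2.map_mk]
  exact List.mem_map_of_mem (hp.mem_edges hx hy (f.map_adj_iff.1 hxy))

theorem isChordless_of_length_eq_dist {u v : V} {p : G.Walk u v} (hp : p.length = G.dist u v) :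
    p.IsChordless := by
  classical
  have mem_edges : ∀ {a b : V} (q : G.Walk a b), q.IsSubwalk p → G.Adj a b → s(a, b) ∈ p.edges := by
    intro a b q hq hab
    have hlen : q.length = 1 :=
      (length_eq_dist_of_subwalk hp hq).trans (dist_eq_one_iff_adj.2 hab)
    match q, hlen with
    | .cons _ .nil, _ => exact hq.edges_subset (by simp)
  rw [Walk.isChordless_iff_forall_mem_edges]
  intro x y hx hy hxy
  by_cases hyx : y ∈ (p.dropUntil x hx).support
  · exact mem_edges _ ((Walk.isSubwalk_takeUntil _ hyx).trans (p.isSubwalk_dropUntil hx)) hxy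
  · have hxy' : y ∈ (p.takeUntil x hx).support := by
      rw [← p.take_spec hx, Walk.mem_support_append_iff] at hy
      exact hy.resolve_right hyx
    rw [Sym2.eq_swap]
    exact mem_edges _ ((Walk.isSubwalk_dropUntil _ hxy').trans (p.isSubwalk_takeUntil hx)) hxy.symm

variable {d y z : V} {q : G.Walk y z}

theorem isCycle_cons_concat (hq : q.IsPath) (hd : d ∉ q.support) (hyz : y ≠ z) (hdy : G.Adj d y)
    (hzd : G.Adj z d) : (Walk.cons hdy (q.concat hzd)).IsCycle := by
  rw [Walk.cons_isCycle_iff, Walk.edges_concat, List.concat_eq_append, List.mem_append,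
    List.mem_singleton, Sym2.eq_swap, Sym2.congr_left]
  exact ⟨hq.concat hd hzd, not_or.2 ⟨fun he => hd (q.snd_mem_support_of_mem_edges he), hyz⟩⟩

theorem isChordless_cons_concat (hq : q.IsChordless)
    (hd : ∀ x ∈ q.support, G.Adj d x → x = y ∨ x = z) (hdy : G.Adj d y) (hzd : G.Adj z d) :
    (Walk.cons hdy (q.concat hzd)).IsChordless := by
  have mem_support : ∀ x ∈ (Walk.cons hdy (q.concat hzd)).support, x = d ∨ x ∈ q.support := by
    intro x hx
    simpa [Walk.support_concat, or_comm, or_assoc] using hx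
  have mem_edges : ∀ x ∈ q.support, G.Adj d x →
      s(d, x) ∈ (Walk.cons hdy (q.concat hzd)).edges := by
    intro x hx hdx
    rcases hd x hx hdx with rfl | rfl <;> simp [Walk.edges_concat, Sym2.eq_swap]
  rw [Walk.isChordless_iff_forall_mem_edges]
  intro a b ha hb hab
  rcases mem_support a ha with rfl | ha' <;> rcases mem_support b hb with rfl | hb'
  · exact absurd rfl hab.ne
  · exact mem_edges b hb' hab
  · exact Sym2.eq_swap ▸ mem_edges a ha' hab.symm
  · simp [Walk.edges_concat, hq.mem_edges ha' hb' hab]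

end Chordless

section Chordal

variable {G : SimpleGraph V} {G' : SimpleGraph W} {A B : Set V}

theorem IsChordal.of_embedding (hG' : IsChordal G') (f : G ↪g G') : IsChordal G := by
  rw [isChordal_iff_not_isChordless] at hG' ⊢
  intro v c hc hl hch
  exact hG' _ (c.map f.toHom) (hc.map f.injective) (by simpa using hl) (isChordless_map f hch)

theorem IsChordal.induce_mono (hB : IsChordal (G.induce B)) (hAB : A ⊆ B) :
    IsChordal (G.induce A) :=
  hB.of_embedding (induceHomOfLE G hAB)

theorem exists_map_hom_eq {S : G.Subgraph} {u v : V} (p : G.Walk u v) (hp : p.toSubgraph ≤ S) :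
    ∃ (hu : u ∈ S.verts) (hv : v ∈ S.verts) (q : S.coe.Walk ⟨u, hu⟩ ⟨v, hv⟩),
      q.map S.hom = p :=
  ⟨hp.1 p.start_mem_verts_toSubgraph, hp.1 p.end_mem_verts_toSubgraph,
    p.mapToSubgraph.map (Subgraph.inclusion hp),
    (Walk.map_map ..).trans p.map_mapToSubgraph_hom⟩

theorem isChordal_induce_of_forall_exists_subgraph
    (h : ∀ (v : V) (c : G.Walk v v), c.IsCycle → (∀ x ∈ c.support, x ∈ A) →
      ∃ S : G.Subgraph, c.toSubgraph ≤ S ∧ IsChordal S.coe) : IsChordal (G.induce A) := by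
  rw [isChordal_iff_not_isChordless]
  intro v c hc hl hch
  have hcA : ∀ x ∈ (c.map (Embedding.induce A).toHom).support, x ∈ A := fun x hx => by
    obtain ⟨y, -, rfl⟩ := List.mem_map.1 (Walk.support_map _ c ▸ hx)
    exact y.2
  obtain ⟨S, hcS, hS⟩ := h v (c.map (Embedding.induce A).toHom) (hc.map Subtype.val_injective) hcA
  obtain ⟨_, _, q, hq⟩ := exists_map_hom_eq _ hcS
  have hlen : q.length = c.length :=
    (Walk.length_map S.hom q).symm.trans ((congrArg Walk.length hq).trans (Walk.length_map _ c))
  exact isChordal_iff_not_isChordless.1 hS _ q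
    ((Walk.isCycle_map_iff_of_injective S.hom_injective).1 (hq ▸ hc.map Subtype.val_injective))
    (hlen ▸ hl) (isChordless_of_map S.hom_injective (hq ▸ isChordless_map _ hch))

theorem exists_isChordless_of_reachable_induce {S : Set V} {y z : V} {hy : y ∈ S} {hz : z ∈ S}
    (h : (G.induce S).Reachable ⟨y, hy⟩ ⟨z, hz⟩) :
    ∃ q : G.Walk y z, q.IsPath ∧ q.IsChordless ∧ ∀ x ∈ q.support, x ∈ S := by
  obtain ⟨p, hp, hlen⟩ := h.exists_path_of_dist
  refine ⟨p.map (Embedding.induce S).toHom, hp.map Subtype.val_injective,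
    isChordless_map _ (isChordless_of_length_eq_dist hlen), fun x hx => ?_⟩
  obtain ⟨x, -, rfl⟩ := List.mem_map.1 (Walk.support_map _ p ▸ hx)
  exact x.2

theorem IsChordal.adj_of_reachable_induce (hG : IsChordal G) {S : Set V} {d y z : V} (hd : d ∉ S)
    (hN : ∀ x ∈ S, G.Adj d x → x = y ∨ x = z) {hy : y ∈ S} {hz : z ∈ S}
    (h : (G.induce S).Reachable ⟨y, hy⟩ ⟨z, hz⟩) (hdy : G.Adj d y) (hdz : G.Adj d z)
    (hyz : y ≠ z) : G.Adj y z := by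
  by_contra hn
  obtain ⟨q, hq, hch, hqS⟩ := exists_isChordless_of_reachable_induce h
  have h0 : q.length ≠ 0 := fun h => hyz (Walk.eq_of_length_eq_zero h)
  have h1 : q.length ≠ 1 := fun h => hn (Walk.adj_of_length_eq_one h)
  exact isChordal_iff_not_isChordless.1 hG d (Walk.cons hdy (q.concat hdz.symm))
    (isCycle_cons_concat hq (fun hmem => hd (hqS d hmem)) hyz hdy hdz.symm)
    (by rw [Walk.length_cons, Walk.length_concat]; omega)
    (isChordless_cons_concat hch (fun x hx => hN x (hqS x hx)) hdy hdz.symm)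

end Chordal

section Simplicial

variable {G : SimpleGraph V} {C : Set V} {c c' d y z : V}

/-- The vertices outside `C` without a neighbour in `C`. If `C` is connected and as large as
possible with `nonNeighbors G C` nonempty, a simplicial vertex is found in this set. -/
def nonNeighbors (G : SimpleGraph V) (C : Set V) : Set V :=
  {d | d ∉ C ∧ ∀ c ∈ C, ¬ G.Adj c d}

theorem exists_maximal_connected_nonNeighbors_nonempty [Finite V] (hG : G ≠ ⊤) :
    ∃ C, Maximal (fun C => (G.induce C).Connected ∧ (nonNeighbors G C).Nonempty) C := by
  obtain ⟨v, w, hvw, hadj⟩ := ne_top_iff_exists_not_adj.1 hG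
  exact (Set.toFinite _).exists_maximal
    ⟨{v}, Connected.of_subsingleton, w, hvw.symm, fun c hc => hc ▸ hadj⟩

theorem adj_of_maximal_connected
    (hC : Maximal (fun C => (G.induce C).Connected ∧ (nonNeighbors G C).Nonempty) C)
    (hc : c ∈ C) (hy : y ∉ C) (hcy : G.Adj c y) (hd : d ∈ nonNeighbors G C) : G.Adj y d := by
  by_contra hyd
  have hconn : (G.induce (C ∪ {c, y})).Connected :=
    induce_union_connected hC.prop.1.preconnected (induce_pair_connected_of_adj hcy).preconnected
      ⟨c, hc, Or.inl rfl⟩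
  have hd' : d ∈ nonNeighbors G (C ∪ {c, y}) := by
    refine ⟨?_, ?_⟩
    · rintro (h | rfl | rfl)
      exacts [hd.1 h, hd.1 hc, hd.2 c hc hcy]
    · rintro x (h | rfl | rfl)
      exacts [hd.2 x h, hd.2 x hc, hyd]
  exact hy (hC.le_of_ge ⟨hconn, d, hd'⟩ Set.subset_union_left (Or.inr (Or.inr rfl)))

theorem IsChordal.adj_of_mem_nonNeighbors (hG : IsChordal G) (hC : (G.induce C).Preconnected)
    (hd : d ∈ nonNeighbors G C) (hc : c ∈ C) (hc' : c' ∈ C) (hcy : G.Adj c y) (hcz : G.Adj c' z)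
    (hyd : G.Adj y d) (hzd : G.Adj z d) (hyz : y ≠ z) : G.Adj y z := by
  have hconn : (G.induce (C ∪ {c, y} ∪ {c', z})).Connected :=
    induce_union_connected (induce_union_connected hC
      (induce_pair_connected_of_adj hcy).preconnected ⟨c, hc, Or.inl rfl⟩).preconnected
      (induce_pair_connected_of_adj hcz).preconnected ⟨c', Or.inl hc', Or.inl rfl⟩
  refine hG.adj_of_reachable_induce (d := d) ?_ ?_
    (hconn.preconnected ⟨y, by simp⟩ ⟨z, by simp⟩) hyd.symm hzd.symm hyz
  · rintro ((h | rfl | rfl) | rfl | rfl)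
    exacts [hd.1 h, hd.1 hc, hyd.ne rfl, hd.1 hc', hzd.ne rfl]
  · rintro x ((h | rfl | rfl) | rfl | rfl) hdx
    exacts [absurd hdx.symm (hd.2 x h), absurd hdx.symm (hd.2 x hc), Or.inl rfl,
      absurd hdx.symm (hd.2 x hc'), Or.inr rfl]

theorem IsChordal.isClique_neighborSet_of_maximal_connected (hG : IsChordal G)
    (hC : Maximal (fun C => (G.induce C).Connected ∧ (nonNeighbors G C).Nonempty) C)
    {x : nonNeighbors G C}
    (hx : (G.induce (nonNeighbors G C)).IsClique ((G.induce _).neighborSet x)) :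
    G.IsClique (G.neighborSet x) := by
  have hnotMem : ∀ {y}, G.Adj x y → y ∉ C := fun hxy hy => x.2.2 _ hy hxy.symm
  have hcases : ∀ {y}, G.Adj x y → y ∈ nonNeighbors G C ∨ ∃ c ∈ C, G.Adj c y := by
    intro y hxy
    by_cases hy : ∃ c ∈ C, G.Adj c y
    · exact Or.inr hy
    · exact Or.inl ⟨hnotMem hxy, fun c hc hcy => hy ⟨c, hc, hcy⟩⟩
  intro y hy z hz hyz
  rcases hcases hy with hyD | ⟨c, hc, hcy⟩ <;> rcases hcases hz with hzD | ⟨c', hc', hcz⟩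
  · exact hx (x := ⟨y, hyD⟩) hy (y := ⟨z, hzD⟩) hz (Subtype.coe_ne_coe.1 hyz)
  · exact (adj_of_maximal_connected hC hc' (hnotMem hz) hcz hyD).symm
  · exact adj_of_maximal_connected hC hc (hnotMem hy) hcy hzD
  · exact hG.adj_of_mem_nonNeighbors hC.prop.1.preconnected x.2 hc hc' hcy hcz hy.symm hz.symm hyz

theorem IsChordal.exists_isClique_neighborSet [Finite V] [Nonempty V] (hG : IsChordal G) :
    ∃ x, G.IsClique (G.neighborSet x) := by
  induction hn : Nat.card V using Nat.strong_induction_on generalizing V with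
  | _ n ih =>
  subst hn
  rcases eq_or_ne G ⊤ with rfl | hne
  · exact ⟨Classical.arbitrary V, fun _ _ _ _ h => h⟩
  obtain ⟨C, hC⟩ := exists_maximal_connected_nonNeighbors_nonempty hne
  have : Nonempty (nonNeighbors G C) := hC.prop.2.to_subtype
  have hlt : Nat.card (nonNeighbors G C) < Nat.card V := by
    obtain ⟨c, hc⟩ := hC.prop.1.nonempty
    exact Finite.card_subtype_lt (x := c) fun h => h.1 hc
  obtain ⟨x, hx⟩ := ih _ hlt (hG.of_embedding (Embedding.induce _)) rfl
  exact ⟨x, hG.isClique_neighborSet_of_maximal_connected hC hx⟩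

end Simplicial

section Elimination

variable {G : SimpleGraph V} {A : Set V}

theorem IsChordal.exists_isClique_neighborSet_inter (hA : A.Finite) (hne : A.Nonempty)
    (hG : IsChordal (G.induce A)) : ∃ x ∈ A, G.IsClique (G.neighborSet x ∩ A) := by
  have := hA.to_subtype
  have := hne.to_subtype
  obtain ⟨x, hx⟩ := hG.exists_isClique_neighborSet
  exact ⟨x, x.2, fun y hy z hz hyz =>
    hx (x := ⟨y, hy.2⟩) hy.1 (y := ⟨z, hz.2⟩) hz.1 (Subtype.coe_ne_coe.1 hyz)⟩

theorem IsChordal.elimination_induction {P : Set V → Prop} (empty : P ∅)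
    (insert : ∀ x A, x ∉ A → G.IsClique (G.neighborSet x ∩ A) → P A → P (insert x A))
    (hA : A.Finite) (hG : IsChordal (G.induce A)) : P A := by
  induction hn : A.ncard generalizing A with
  | zero => rwa [(Set.ncard_eq_zero hA).1 hn]
  | succ n ih =>
    obtain ⟨x, hxA, hx⟩ :=
      hG.exists_isClique_neighborSet_inter hA (Set.nonempty_of_ncard_ne_zero (by omega))
    have hsub : A \ {x} ⊆ A := Set.sdiff_subset
    rw [← Set.insert_sdiff_self_of_mem hxA]
    refine insert x _ (fun h => h.2 rfl) (hx.subset (Set.inter_subset_inter_right _ hsub))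
      (ih (hA.subset hsub) (hG.induce_mono hsub) ?_)
    rw [Set.ncard_sdiff_singleton_of_mem hxA, hn, Nat.add_sub_cancel]

end Elimination

section JoinForest

variable {K : ι → Set W} {S S₀ : Set W} {T : SimpleGraph W}

/-- A forest on `S` in which every set `K x` traces out a subtree. For a family of bags indexed by
`S`, with `K x` the set of the bags that contain `x`, this is a join forest (junction forest). -/
structure IsJoinForest (K : ι → Set W) (S : Set W) (T : SimpleGraph W) : Prop where
  acyclic : T.IsAcyclic
  support_subset : T.support ⊆ S
  preconnected : ∀ x, (T.induce (S ∩ K x)).Preconnected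

theorem IsJoinForest.sup_starGraph (hT : IsJoinForest K S₀ T) (hS : S₀ ⊆ S) {j : W} (hj : j ∈ S₀)
    (h : ∀ i ∈ S \ S₀, ∀ x, i ∈ K x → j ∈ K x) :
    IsJoinForest K S (T ⊔ ((starGraph j).induce (insert j (S \ S₀))).spanningCoe) where
  acyclic := by
    refine isAcyclic_sup hT.acyclic ((isAcyclic_starGraph j).anti (spanningCoe_induce_le _ _)) ?_
    have eq_j : ∀ s ∈ T.support ∩ ((starGraph j).induce (insert j (S \ S₀))).spanningCoe.support,
        s = j := fun s hs => (support_spanningCoe_induce_subset hs.2).resolve_right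
      fun hn => hn.2 (hT.support_subset hs.1)
    intro s hs t ht
    rw [eq_j s hs, eq_j t ht]
  support_subset := by
    rintro a ⟨b, hab | hab⟩
    · exact hS (hT.support_subset ⟨b, hab⟩)
    · rcases (spanningCoe_induce_adj.1 hab).2.1 with rfl | ha
      exacts [hS hj, ha.1]
  preconnected x := by
    set T' := T ⊔ ((starGraph j).induce (insert j (S \ S₀))).spanningCoe
    have hle : S₀ ∩ K x ⊆ S ∩ K x := Set.inter_subset_inter_left _ hS
    have reachable_old : ∀ a : ↑(S ∩ K x), ∃ b : ↑(S₀ ∩ K x),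
        (T'.induce (S ∩ K x)).Reachable a ⟨b, hle b.2⟩ := by
      rintro ⟨a, haS, hax⟩
      by_cases ha : a ∈ S₀
      · exact ⟨⟨a, ha, hax⟩, Reachable.refl _⟩
      · refine ⟨⟨j, hj, h a ⟨haS, ha⟩ x hax⟩, Adj.reachable (Or.inr ?_)⟩
        refine spanningCoe_induce_adj.2 ⟨?_, Or.inr ⟨haS, ha⟩, Or.inl rfl⟩
        exact starGraph_adj.2 ⟨fun haj : a = j => ha (haj ▸ hj), Or.inr rfl⟩
    intro a b
    obtain ⟨a', ha⟩ := reachable_old a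
    obtain ⟨b', hb⟩ := reachable_old b
    exact ha.trans ((reachable_induce_mono hle ((spanningCoe_induce_le _ _).trans le_sup_left)
      (hT.preconnected x a' b')).trans hb.symm)

theorem IsChordal.exists_isJoinForest {G : SimpleGraph V} {A : Set V} (hG : IsChordal (G.induce A))
    (hA : A.Finite) (K : V → Set W) (S : Set W)
    (hbag : ∀ i ∈ S, G.IsClique {x ∈ A | i ∈ K x})
    (hcover : ∀ Q ⊆ A, G.IsClique Q → ∃ i ∈ S, ∀ x ∈ Q, i ∈ K x) :
    ∃ T, IsJoinForest (fun x : A => K x) S T := by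
  refine hG.elimination_induction (P := fun A => ∀ S : Set W,
    (∀ i ∈ S, G.IsClique {x ∈ A | i ∈ K x}) →
    (∀ Q ⊆ A, G.IsClique Q → ∃ i ∈ S, ∀ x ∈ Q, i ∈ K x) →
    ∃ T, IsJoinForest (fun x : A => K x) S T) ?_ ?_ hA S hbag hcover
  · exact fun S _ _ => ⟨⊥, isAcyclic_bot, by simp, fun x => x.2.elim⟩
  clear! A S
  intro x A hxA hx ih S hbag hcover
  have hsub : A ⊆ insert x A := Set.subset_insert x A
  obtain ⟨j, hjS, hj⟩ := hcover (insert x (G.neighborSet x ∩ A))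
    (Set.insert_subset_insert Set.inter_subset_right) (hx.insert fun y hy _ => hy.1)
  have mem_of_mem : ∀ i ∈ S, i ∈ K x → ∀ y ∈ A, i ∈ K y → j ∈ K y := fun i hi hix y hy hiy =>
    hj y (Or.inr ⟨hbag i hi ⟨Or.inl rfl, hix⟩ ⟨hsub hy, hiy⟩ fun h => hxA (h ▸ hy), hy⟩)
  have hS₀ : {i ∈ S | i ∈ K x → i = j} ⊆ S := Set.sep_subset _ _
  obtain ⟨T, hT⟩ := ih {i ∈ S | i ∈ K x → i = j}
    (fun i hi => (hbag i hi.1).subset (Set.inter_subset_inter_left _ hsub)) (by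
      intro Q hQA hQ
      obtain ⟨i, hi, hiQ⟩ := hcover Q (hQA.trans hsub) hQ
      by_cases hix : i ∈ K x
      · exact ⟨j, ⟨hjS, fun _ => rfl⟩, fun y hy => mem_of_mem i hi hix y (hQA hy) (hiQ y hy)⟩
      · exact ⟨i, ⟨hi, fun h => absurd h hix⟩, hiQ⟩)
  have hT' : IsJoinForest (fun y : ↑(insert x A) => K y) {i ∈ S | i ∈ K x → i = j} T := by
    refine ⟨hT.acyclic, hT.support_subset, ?_⟩
    rintro ⟨y, rfl | hy⟩
    · rintro ⟨a, ha, hay⟩ ⟨b, hb, hby⟩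
      obtain rfl := (ha.2 hay).trans (hb.2 hby).symm
      exact Reachable.refl _
    · exact hT.preconnected ⟨y, hy⟩
  refine ⟨_, hT'.sup_starGraph hS₀ ⟨hjS, fun _ => rfl⟩ ?_⟩
  rintro i ⟨hiS, hi⟩ ⟨y, rfl | hy⟩ hiy
  · exact hj y (Or.inl rfl)
  · exact mem_of_mem i hiS (by_contra fun h => hi ⟨hiS, fun h' => absurd h' h⟩) y hy hiy

end JoinForest

section Substitution

variable {K : ι → Set W} {u v : ι} {T R : SimpleGraph W} {S : Set W}

/-- The graph obtained from `T` by replacing its edges inside `S` by those of `R`: the exchange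
step comparing two join forests on their overlap `S`. -/
def replaceOn (T R : SimpleGraph W) (S : Set W) : SimpleGraph W :=
  (R.induce S).spanningCoe ⊔ T \ (T.induce S).spanningCoe

theorem IsJoinForest.replaceOn (hT : IsJoinForest K (K v) T) (hR : IsJoinForest K (K u) R) :
    IsJoinForest K (K v) (replaceOn T R (K v ∩ K u)) where
  acyclic := by
    refine isAcyclic_sup_sdiff (hR.acyclic.anti (spanningCoe_induce_le _ _)) hT.acyclic
      (spanningCoe_induce_le _ _) fun s hs t ht => ?_
    exact reachable_spanningCoe_induce (hT.preconnected u)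
      (support_spanningCoe_induce_subset hs.1) (support_spanningCoe_induce_subset ht.1)
  support_subset := by
    rintro a ⟨b, hab | hab⟩
    · exact (spanningCoe_induce_adj.1 hab).2.1.1
    · exact hT.support_subset ⟨b, hab.1⟩
  preconnected x := by
    refine preconnected_of_forall_adj_reachable (hT.preconnected x) ?_
    rintro ⟨c, hcv, hcx⟩ ⟨d, hdv, hdx⟩ hcd
    by_cases h : c ∈ K u ∧ d ∈ K u
    · have hRuvx : (R.induce ((K u ∩ K v) ∩ (K u ∩ K x))).Preconnected :=
        preconnected_induce_inter hR.acyclic (hR.preconnected v) (hR.preconnected x)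
      have hsub : (K u ∩ K v) ∩ (K u ∩ K x) ⊆ K v ∩ K x := fun y hy => ⟨hy.1.2, hy.2.2⟩
      refine reachable_induce_mono hsub (fun y z hyz => ?_)
        (hRuvx ⟨c, ⟨h.1, hcv⟩, h.1, hcx⟩ ⟨d, ⟨h.2, hdv⟩, h.2, hdx⟩)
      obtain ⟨hyz, hy, hz⟩ := spanningCoe_induce_adj.1 hyz
      exact Or.inl (spanningCoe_induce_adj.2 ⟨hyz, hy.1.symm, hz.1.symm⟩)
    · refine Adj.reachable (Or.inr ⟨hcd, fun h' => h ?_⟩)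
      obtain ⟨-, hc, hd⟩ := spanningCoe_induce_adj.1 h'
      exact ⟨hc.2, hd.2⟩

theorem exists_injective_additive_weight [Finite W] : ∃ w : SimpleGraph W → ℕ,
    Function.Injective w ∧ ∀ G G', Disjoint G G' → w (G ⊔ G') = w G + w G' := by
  classical
  have := Fintype.ofFinite W
  obtain ⟨f, hf⟩ := Countable.exists_injective_nat (Sym2 W)
  refine ⟨fun G => ∑ e ∈ G.edgeFinset, 2 ^ f e, fun G G' h => ?_, fun G G' h => ?_⟩
  · simp only [← Finset.sum_image (f := (2 ^ ·)) hf.injOn] at h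
    exact edgeFinset_inj.1 (Finset.image_injective hf (Finset.geomSum_injective le_rfl h))
  · simp only [edgeFinset_sup, Finset.sum_union (disjoint_edgeFinset.2 h)]

-- Take each forest of minimal weight. By the exchange `replaceOn` and additivity, two of them have
-- the same weight on their overlap, and then they agree there since the weight is injective.
theorem exists_isJoinForest_induce_eq [Finite W] (h : ∀ v, ∃ T, IsJoinForest K (K v) T) :
    ∃ T : ι → SimpleGraph W, (∀ v, IsJoinForest K (K v) (T v)) ∧
      ∀ u v, (T u).induce (K u ∩ K v) = (T v).induce (K u ∩ K v) := by
  obtain ⟨w, hw, hadd⟩ := exists_injective_additive_weight (W := W)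
  have exists_min : ∀ v, ∃ T, IsJoinForest K (K v) T ∧
      ∀ T', IsJoinForest K (K v) T' → w T ≤ w T' :=
    fun v => Set.exists_min_image {T | IsJoinForest K (K v) T} w (Set.toFinite _) (h v)
  choose T hT hmin using exists_min
  have hle : ∀ u v, w ((T v).induce (K v ∩ K u)).spanningCoe ≤
      w ((T u).induce (K v ∩ K u)).spanningCoe := by
    intro u v
    have hreplace := hmin v _ ((hT v).replaceOn (hT u))
    rw [replaceOn, hadd _ _ ?_] at hreplace
    · have hsplit := hadd ((T v).induce (K v ∩ K u)).spanningCoe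
        (T v \ ((T v).induce (K v ∩ K u)).spanningCoe) disjoint_sdiff_self_right
      rw [sup_sdiff_cancel_right (spanningCoe_induce_le _ _)] at hsplit
      omega
    · refine disjoint_left.2 fun a b hab hab' => hab'.2 ?_
      exact spanningCoe_induce_adj.2 ⟨hab'.1, (spanningCoe_induce_adj.1 hab).2⟩
  refine ⟨T, hT, fun u v => map_injective (.subtype _) (hw (le_antisymm ?_ ?_))⟩
  · exact hle v u
  · rw [Set.inter_comm]; exact hle u v

theorem exists_isJoinForest_induce [Finite W] (h : ∀ v, ∃ T, IsJoinForest K (K v) T) :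
    ∃ H : SimpleGraph W, (∀ v, IsJoinForest K (K v) (H.induce (K v)).spanningCoe) ∧
      ∀ a b, H.Adj a b → ∃ v, a ∈ K v ∧ b ∈ K v := by
  obtain ⟨T, hT, hTT⟩ := exists_isJoinForest_induce_eq h
  have mem : ∀ v a b, (T v).Adj a b → a ∈ K v ∧ b ∈ K v := fun v a b hab =>
    ⟨(hT v).support_subset ⟨b, hab⟩, (hT v).support_subset ⟨a, hab.symm⟩⟩
  have induce_eq : ∀ v, ((⨆ u, T u).induce (K v)).spanningCoe = T v := by
    intro v
    ext a b
    rw [spanningCoe_induce_adj, iSup_adj]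
    refine ⟨fun ⟨⟨u, hab⟩, ha, hb⟩ => ?_, fun hab => ⟨⟨v, hab⟩, mem v a b hab⟩⟩
    obtain ⟨hau, hbu⟩ := mem u a b hab
    have hadj : ((T u).induce (K u ∩ K v)).Adj ⟨a, hau, ha⟩ ⟨b, hbu, hb⟩ := hab
    rw [hTT] at hadj
    exact hadj
  refine ⟨⨆ v, T v, fun v => (induce_eq v).symm ▸ hT v, fun a b hab => ?_⟩
  obtain ⟨v, hv⟩ := iSup_adj.1 hab
  exact ⟨v, mem v a b hv⟩

end Substitution

section RegionUnion

variable {H : SimpleGraph W} {K : V → Set W} {X : Set V} {a b : W}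

/-- The union of the regions `H[K v]`, for `v` in `X`, as a graph on all vertices of `H`. -/
def regionUnion (H : SimpleGraph W) (K : V → Set W) (X : Set V) : SimpleGraph W :=
  ⨆ v ∈ X, (H.induce (K v)).spanningCoe

theorem regionUnion_adj :
    (regionUnion H K X).Adj a b ↔ ∃ v ∈ X, H.Adj a b ∧ a ∈ K v ∧ b ∈ K v := by
  simp only [regionUnion, iSup_adj, spanningCoe_induce_adj, exists_prop]

theorem spanningCoe_induce_le_regionUnion {v : V} (hv : v ∈ X) :
    (H.induce (K v)).spanningCoe ≤ regionUnion H K X :=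
  le_biSup (fun v => (H.induce (K v)).spanningCoe) hv

theorem isJoinForest_induce_of_isAcyclic_pair (hconn : ∀ v, (H.induce (K v)).Preconnected)
    (hpair : ∀ u v, (regionUnion H K {u, v}).IsAcyclic) (v : V) :
    IsJoinForest K (K v) (H.induce (K v)).spanningCoe where
  acyclic := (hpair v v).anti (spanningCoe_induce_le_regionUnion (Or.inl rfl))
  support_subset := support_spanningCoe_induce_subset
  preconnected u := by
    have hregion : ∀ w ∈ ({v, u} : Set V), ((regionUnion H K {v, u}).induce (K w)).Preconnected :=
      fun w hw => (hconn w).mono fun a b hab => regionUnion_adj.2 ⟨w, hw, hab, a.2, b.2⟩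
    refine (preconnected_induce_inter (hpair v u) (hregion v (Or.inl rfl))
      (hregion u (Or.inr rfl))).mono fun a b hab => ?_
    obtain ⟨_, _, hab, -⟩ := regionUnion_adj.1 hab
    exact spanningCoe_induce_adj.2 ⟨hab, a.2.1, b.2.1⟩

theorem isAcyclic_regionUnion {G : SimpleGraph V} (hbag : ∀ i, G.IsClique {x | i ∈ K x})
    (hcover : ∀ Q, G.IsClique Q → ∃ i, ∀ x ∈ Q, i ∈ K x)
    (hforest : ∀ v, IsJoinForest K (K v) (H.induce (K v)).spanningCoe)
    (hX : X.Finite) (hG : IsChordal (G.induce X)) : (regionUnion H K X).IsAcyclic := by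
  refine hG.elimination_induction (P := fun X => (regionUnion H K X).IsAcyclic) ?_ ?_ hX
  · simp only [regionUnion, Set.mem_empty_iff_false, iSup_false, iSup_bot, isAcyclic_bot]
  intro x A hxA hx ih
  obtain ⟨j, hj⟩ := hcover (insert x (G.neighborSet x ∩ A)) (hx.insert fun y hy _ => hy.1)
  rw [regionUnion, iSup_insert]
  refine isAcyclic_sup (hforest x).acyclic ih ?_
  suffices reachable : ∀ s ∈ (H.induce (K x)).spanningCoe.support ∩ (regionUnion H K A).support,
      ((H.induce (K x)).spanningCoe ⊓ regionUnion H K A).Reachable s j from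
    fun s hs t ht => (reachable s hs).trans (reachable t ht).symm
  rintro s ⟨hsx, t, hst⟩
  obtain ⟨y, hyA, -, hsy, -⟩ := regionUnion_adj.1 hst
  have hsx : s ∈ K x := support_spanningCoe_induce_subset hsx
  have hxy : G.Adj x y := hbag s hsx hsy fun h => hxA (h ▸ hyA)
  refine (reachable_spanningCoe_induce ((hforest x).preconnected y) ⟨hsx, hsy⟩
    ⟨hj x (Or.inl rfl), hj y (Or.inr ⟨hxy, hyA⟩)⟩).mono fun a b hab => ?_
  obtain ⟨hab, ha, hb⟩ := spanningCoe_induce_adj.1 hab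
  exact ⟨hab, regionUnion_adj.2 ⟨y, hyA, (spanningCoe_induce_adj.1 hab).1, ha.2, hb.2⟩⟩

end RegionUnion

section LocallyChordal

variable {G : SimpleGraph V} {r : ℕ}

theorem edist_add_edist_lt_length {w a b : V} {c : G.Walk w w} (h : s(a, b) ∈ c.edges) :
    G.edist w a + G.edist w b < c.length := by
  have of_append : ∀ {a b : V} (hab : G.Adj a b) (p : G.Walk w a) (q : G.Walk b w),
      G.edist w a + G.edist w b < ((p.append hab.toWalk).append q).length := by
    intro a b hab p q
    calc G.edist w a + G.edist w b ≤ p.length + q.length :=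
          add_le_add (edist_le p) (edist_comm (G := G) ▸ edist_le q)
      _ < ((p.append hab.toWalk).append q).length := by
          simp only [Walk.length_append, Walk.length_cons, Walk.length_nil]
          exact_mod_cast (by omega)
  rcases (Walk.isSubwalk_toWalk_iff_mem_edges (c.adj_of_mem_edges h)).2 h with
    ⟨p, q, hc⟩ | ⟨p, q, hc⟩
  · exact hc ▸ of_append _ p q
  · exact hc ▸ add_comm (G.edist w b) _ ▸ of_append _ p q

theorem toSubgraph_le_halfBall {v w : V} {c : G.Walk w w} (hc : ¬c.Nil)
    (h : ∀ a b, s(a, b) ∈ c.edges → G.edist v a + G.edist v b < r) :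
    c.toSubgraph ≤ halfBall G v r := by
  rw [Walk.toSubgraph_le_iff hc]
  intro e he
  induction e with
  | h a b => exact ⟨c.adj_of_mem_edges he, h a b he⟩

theorem IsLocallyChordal.isChordal_induce_closedNeighborhood (hG : IsLocallyChordal G r)
    (hr : 3 ≤ r) (v : V) : IsChordal (G.induce (insert v (G.neighborSet v))) := by
  refine isChordal_induce_of_forall_exists_subgraph fun w c hc hcA =>
    ⟨halfBall G v r, toSubgraph_le_halfBall hc.not_nil fun a b hab => ?_, hG v⟩
  have edist_le_one : ∀ x ∈ c.support, G.edist v x ≤ 1 := fun x hx =>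
    edist_le_one_iff_adj_or_eq.2 ((hcA x hx).symm.imp id Eq.symm)
  calc G.edist v a + G.edist v b ≤ 1 + 1 :=
        add_le_add (edist_le_one a (c.fst_mem_support_of_mem_edges hab))
          (edist_le_one b (c.snd_mem_support_of_mem_edges hab))
    _ < (r : ℕ∞) := by rw [one_add_one_eq_two]; exact_mod_cast hr

theorem length_le_card_of_isCycle {w : V} {c : G.Walk w w} (hc : c.IsCycle) {X : Finset V}
    (h : ∀ x ∈ c.support, x ∈ X) : c.length ≤ X.card := by
  classical
  calc c.length = c.support.tail.length := by
        rw [List.length_tail, Walk.length_support, Nat.add_sub_cancel]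
    _ = c.support.tail.toFinset.card := (List.toFinset_card_of_nodup hc.support_nodup).symm
    _ ≤ X.card :=
        Finset.card_le_card fun x hx => h x (List.mem_of_mem_tail (List.mem_toFinset.1 hx))

theorem IsLocallyChordal.isChordal_induce_of_card_le (hG : IsLocallyChordal G r) {X : Finset V}
    (hX : X.card ≤ r) : IsChordal (G.induce (X : Set V)) :=
  isChordal_induce_of_forall_exists_subgraph fun w _ hc hcX =>
    ⟨halfBall G w r, toSubgraph_le_halfBall hc.not_nil fun _ _ hab =>
      (edist_add_edist_lt_length hab).trans_le
        (Nat.cast_le.2 ((length_le_card_of_isCycle hc hcX).trans hX)), hG w⟩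

end LocallyChordal

section Subgraph

variable {G : SimpleGraph V}

theorem isAcyclic_coe_iff_spanningCoe {S : G.Subgraph} :
    S.coe.IsAcyclic ↔ S.spanningCoe.IsAcyclic := by
  refine ⟨fun h v c hc => ?_, fun h => h.comap ⟨Subtype.val, fun h => h⟩ Subtype.val_injective⟩
  have hc' : (c.mapLe S.spanningCoe_le).IsCycle := hc.mapLe _
  have hcS : (c.mapLe S.spanningCoe_le).toSubgraph ≤ S := by
    refine (Walk.toSubgraph_le_iff hc'.not_nil).2 fun e he => ?_
    rw [Walk.mem_edgeSet, Walk.edges_mapLe_eq_edges] at he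
    exact S.edgeSet_spanningCoe ▸ c.edges_subset_edgeSet he
  obtain ⟨_, _, q, hq⟩ := exists_map_hom_eq _ hcS
  exact h q ((Walk.isCycle_map_iff_of_injective S.hom_injective).1 (hq ▸ hc'))

theorem coe_induce {H : G.Subgraph} {s : Set V} :
    (H.induce s).coe = H.spanningCoe.induce s := by
  ext a b
  exact ⟨fun h => h.2.2, fun h => ⟨a.2, b.2, h⟩⟩

theorem ncard_edgeSet_coe (S : G.Subgraph) : S.coe.edgeSet.ncard = S.edgeSet.ncard := by
  rw [← S.image_coe_edgeSet_coe,
    Set.ncard_image_of_injective _ (Sym2.map.injective Subtype.val_injective)]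

theorem ncard_edgeSet_add_one_le [Finite V] [Nonempty V] (hG : G.IsAcyclic) :
    G.edgeSet.ncard + 1 ≤ Nat.card V := by
  obtain ⟨T, hGT, -, hT⟩ :=
    (connected_top (V := V)).exists_isTree_le_of_le_of_isAcyclic le_top hG
  exact (isTree_iff_connected_and_card.1 hT).2 ▸
    Nat.succ_le_succ (Set.ncard_le_ncard (edgeSet_subset_edgeSet.2 hGT))

theorem ncard_edgeSet_add_one_eq_iff [Finite V] [Nonempty V] (hG : G.IsAcyclic) :
    G.edgeSet.ncard + 1 = Nat.card V ↔ G.Connected := by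
  refine ⟨fun h => ?_, fun h => (isTree_iff_connected_and_card.1 ⟨h, hG⟩).2⟩
  obtain ⟨T, hGT, -, hT⟩ :=
    (connected_top (V := V)).exists_isTree_le_of_le_of_isAcyclic le_top hG
  have hcard := h.trans (isTree_iff_connected_and_card.1 hT).2.symm
  have hedge : G.edgeSet = T.edgeSet := Set.eq_of_subset_of_ncard_le
    (edgeSet_subset_edgeSet.2 hGT) (Nat.succ_le_succ_iff.1 hcard.ge)
  exact edgeSet_inj.1 hedge ▸ hT.connected

end Subgraph

section AcyclicFamily

variable {Γ : SimpleGraph W} {F : V → Γ.Subgraph} {r s : ℕ}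

theorem IsAcyclicFamily.mono (h : IsAcyclicFamily F s) (hrs : r ≤ s) : IsAcyclicFamily F r :=
  fun X hX => h X (hX.trans hrs)

theorem IsAcyclicFamily.isAcyclic_coe (h : IsAcyclicFamily F r) (hr : 1 ≤ r) (v : V) :
    (F v).coe.IsAcyclic := by
  have hv := h {v} hr
  rwa [Finset.iSup_singleton] at hv

variable {G : SimpleGraph V} {H : (cliqueIntersectionGraph G).Subgraph}

theorem IsAcyclicSpanning.isAcyclic_coe_coPart (h : IsAcyclicSpanning G r H) (hr : 1 ≤ r) (v : V) :
    (coPart G H v).coe.IsAcyclic :=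
  h.2.isAcyclic_coe hr v

theorem IsAcyclicCliqueGraph.isAcyclicSpanning (h : IsAcyclicCliqueGraph G s H) (hrs : r ≤ s) :
    IsAcyclicSpanning G r H :=
  ⟨h.1.1, h.2.mono hrs⟩

theorem spanningCoe_iSup_coPart (X : Finset V) : (⨆ v ∈ X, coPart G H v).spanningCoe =
    regionUnion H.spanningCoe (cliquesThrough G) (X : Set V) := by
  ext M N
  simp only [Subgraph.spanningCoe_adj, Subgraph.iSup_adj, regionUnion_adj, exists_prop]
  exact exists_congr fun v => and_congr_right fun _ => ⟨fun h => ⟨h.2.2, h.1, h.2.1⟩,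
    fun h => ⟨h.2.1, h.2.2, h.1⟩⟩

theorem isAcyclicFamily_coPart_iff : IsAcyclicFamily (coPart G H) r ↔ ∀ X : Finset V,
    X.card ≤ r → (regionUnion H.spanningCoe (cliquesThrough G) (X : Set V)).IsAcyclic :=
  forall₂_congr fun X _ => by rw [isAcyclic_coe_iff_spanningCoe, spanningCoe_iSup_coPart]

end AcyclicFamily

section CliqueGraph

variable [Finite V] {G : SimpleGraph V} {H : (cliqueIntersectionGraph G).Subgraph} {r : ℕ}

theorem exists_maxClique_of_isClique {Q : Set V} (hQ : G.IsClique Q) :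
    ∃ M : MaxClique G, Q ⊆ M.1 := by
  obtain ⟨M, hQM, hM⟩ := (Set.toFinite {Q : Set V | G.IsClique Q}).exists_le_maximal hQ
  exact ⟨⟨M, hM⟩, hQM⟩

theorem cliquesThrough_nonempty (v : V) : (cliquesThrough G v).Nonempty := by
  obtain ⟨M, hM⟩ := exists_maxClique_of_isClique (G := G) (isClique_singleton v)
  exact ⟨M, hM rfl⟩

theorem adj_iff_cliquesThrough_inter_nonempty {u v : V} (huv : u ≠ v) :
    G.Adj u v ↔ (cliquesThrough G u ∩ cliquesThrough G v).Nonempty := by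
  refine ⟨fun h => ?_, fun ⟨M, hu, hv⟩ => M.2.prop hu hv huv⟩
  obtain ⟨M, hM⟩ := exists_maxClique_of_isClique (G := G) (isClique_pair.2 fun _ => h)
  exact ⟨M, hM (Or.inl rfl), hM (Or.inr rfl)⟩

theorem isCliqueGraph_of_connected (hH : H.IsSpanning) (h : ∀ v, (coPart G H v).Connected) :
    IsCliqueGraph G H :=
  ⟨hH, fun _ => ⟨fun M _ => hH M, fun _ _ hMN => hMN.2.2⟩, h,
    fun _ _ huv => adj_iff_cliquesThrough_inter_nonempty huv⟩

theorem coPart_connected_iff {v : V} :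
    (coPart G H v).Connected ↔ (H.spanningCoe.induce (cliquesThrough G v)).Preconnected := by
  rw [Subgraph.connected_iff', coPart, coe_induce]
  exact ⟨Connected.preconnected, fun h =>
    (connected_iff _).2 ⟨h, (cliquesThrough_nonempty v).to_subtype⟩⟩

theorem exists_isJoinForest_cliquesThrough {v : V}
    (h : IsChordal (G.induce (insert v (G.neighborSet v)))) :
    ∃ T, IsJoinForest (cliquesThrough G) (cliquesThrough G v) T := by
  obtain ⟨T, hT⟩ := h.exists_isJoinForest (Set.toFinite _) (cliquesThrough G) (cliquesThrough G v)
    (fun M _ => M.2.prop.subset fun x hx => hx.2) fun Q hQ hQc => by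
      obtain ⟨M, hM⟩ := exists_maxClique_of_isClique (hQc.insert fun u hu huv =>
        (hQ hu).resolve_left huv.symm)
      exact ⟨M, hM (Set.mem_insert v Q), fun x hx => hM (Set.mem_insert_of_mem v hx)⟩
  refine ⟨T, hT.acyclic, hT.support_subset, fun x => ?_⟩
  by_cases hx : x ∈ insert v (G.neighborSet v)
  · exact hT.preconnected ⟨x, hx⟩
  · rintro ⟨M, hMv, hMx⟩
    exact absurd (or_iff_not_imp_left.2 fun hxv => M.2.prop hMv hMx (Ne.symm hxv)) hx

theorem IsLocallyChordal.isAcyclicFamily_coPart (hG : IsLocallyChordal G r)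
    (hH : ∀ v, IsJoinForest (cliquesThrough G) (cliquesThrough G v)
      (H.spanningCoe.induce (cliquesThrough G v)).spanningCoe) :
    IsAcyclicFamily (coPart G H) r :=
  isAcyclicFamily_coPart_iff.2 fun X hX => isAcyclic_regionUnion (fun M => M.2.prop)
    (fun _ => exists_maxClique_of_isClique) hH X.finite_toSet (hG.isChordal_induce_of_card_le hX)

theorem IsLocallyChordal.isAcyclicCliqueGraph_of_connected (hG : IsLocallyChordal G r)
    (hH : IsAcyclicSpanning G 2 H) (hconn : ∀ v, (coPart G H v).Connected) :
    IsAcyclicCliqueGraph G r H := by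
  refine ⟨isCliqueGraph_of_connected hH.1 hconn, hG.isAcyclicFamily_coPart ?_⟩
  classical
  refine isJoinForest_induce_of_isAcyclic_pair (fun v => coPart_connected_iff.1 (hconn v))
    fun u v => ?_
  rw [← Finset.coe_pair]
  exact isAcyclicFamily_coPart_iff.1 hH.2 {u, v} Finset.card_le_two

theorem IsLocallyChordal.exists_isAcyclicCliqueGraph (hG : IsLocallyChordal G r) (hr : 3 ≤ r) :
    ∃ H, IsAcyclicCliqueGraph G r H := by
  obtain ⟨T, hT, hTadj⟩ := exists_isJoinForest_induce fun v =>
    exists_isJoinForest_cliquesThrough (hG.isChordal_induce_closedNeighborhood hr v)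
  have hle : T ≤ cliqueIntersectionGraph G := fun M N hMN => ⟨hMN.ne, hTadj M N hMN⟩
  refine ⟨toSubgraph T hle, isCliqueGraph_of_connected (toSubgraph.isSpanning T hle) fun v =>
    coPart_connected_iff.2 ?_, hG.isAcyclicFamily_coPart hT⟩
  refine ((Set.inter_self (cliquesThrough G v)) ▸ (hT v).preconnected v).mono fun M N hMN => ?_
  exact (spanningCoe_induce_adj.1 hMN).1

end CliqueGraph

section Weight

theorem finsum_ncard_comm {α β : Type*} [Finite α] [Finite β] (R : α → β → Prop) :
    ∑ᶠ a, {b | R a b}.ncard = ∑ᶠ b, {a | R a b}.ncard := by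
  classical
  have := Fintype.ofFinite α
  have := Fintype.ofFinite β
  simp only [finsum_eq_sum_of_fintype, Set.ncard_eq_toFinset_card', Set.toFinset_ofPred]
  exact Finset.sum_card_bipartiteAbove_eq_sum_card_bipartiteBelow R

variable {G : SimpleGraph V} {H : (cliqueIntersectionGraph G).Subgraph}

theorem mem_edgeSet_coPart {v : V} {M N : MaxClique G} :
    s(M, N) ∈ (coPart G H v).edgeSet ↔ v ∈ M.1 ∩ N.1 ∧ s(M, N) ∈ H.edgeSet :=
  and_assoc.symm

theorem finsum_edgeWeight_eq_ncard (e : Sym2 (MaxClique G)) :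
    ∑ᶠ _ : e ∈ H.edgeSet, edgeWeight G e = {v | e ∈ (coPart G H v).edgeSet}.ncard := by
  induction e with
  | h M N =>
    simp only [mem_edgeSet_coPart]
    by_cases he : s(M, N) ∈ H.edgeSet
    · simp only [he, finsum_true, and_true]
      rfl
    · simp only [he, finsum_false, and_false, Set.ofPred_false, Set.ncard_empty]

variable [Finite V]

theorem totalWeight_eq_finsum : totalWeight G H = ∑ᶠ v, (coPart G H v).edgeSet.ncard :=
  (finsum_congr finsum_edgeWeight_eq_ncard).trans
    (finsum_ncard_comm fun e v => e ∈ (coPart G H v).edgeSet)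

theorem finsum_ncard_cliquesThrough :
    ∑ᶠ v, (cliquesThrough G v).ncard = ∑ᶠ K : MaxClique G, K.1.ncard :=
  finsum_ncard_comm fun v (K : MaxClique G) => v ∈ K.1

theorem ncard_edgeSet_coPart_add_one_le {v : V} (h : (coPart G H v).coe.IsAcyclic) :
    (coPart G H v).edgeSet.ncard + 1 ≤ (cliquesThrough G v).ncard := by
  have : Nonempty (coPart G H v).verts := (cliquesThrough_nonempty v).to_subtype
  exact ncard_edgeSet_coe (coPart G H v) ▸ ncard_edgeSet_add_one_le h

theorem ncard_edgeSet_coPart_add_one_eq_iff {v : V} (h : (coPart G H v).coe.IsAcyclic) :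
    (coPart G H v).edgeSet.ncard + 1 = (cliquesThrough G v).ncard ↔
      (coPart G H v).Connected := by
  have : Nonempty (coPart G H v).verts := (cliquesThrough_nonempty v).to_subtype
  rw [Subgraph.connected_iff', ← ncard_edgeSet_add_one_eq_iff h, ncard_edgeSet_coe]
  rfl

theorem totalWeight_add_card :
    totalWeight G H + Nat.card V = ∑ᶠ v, ((coPart G H v).edgeSet.ncard + 1) := by
  have := Fintype.ofFinite V
  simp only [totalWeight_eq_finsum, finsum_eq_sum_of_fintype, Finset.sum_add_distrib,
    Nat.card_eq_fintype_card, Fintype.card_eq_sum_ones]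

theorem totalWeight_add_card_le (h : ∀ v, (coPart G H v).coe.IsAcyclic) :
    totalWeight G H + Nat.card V ≤ ∑ᶠ K : MaxClique G, K.1.ncard := by
  have := Fintype.ofFinite V
  rw [totalWeight_add_card, ← finsum_ncard_cliquesThrough, finsum_eq_sum_of_fintype,
    finsum_eq_sum_of_fintype]
  exact Finset.sum_le_sum fun v _ => ncard_edgeSet_coPart_add_one_le (h v)

theorem totalWeight_add_card_eq_iff (h : ∀ v, (coPart G H v).coe.IsAcyclic) :
    totalWeight G H + Nat.card V = ∑ᶠ K : MaxClique G, K.1.ncard ↔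
      ∀ v, (coPart G H v).Connected := by
  have := Fintype.ofFinite V
  rw [totalWeight_add_card, ← finsum_ncard_cliquesThrough, finsum_eq_sum_of_fintype,
    finsum_eq_sum_of_fintype,
    Finset.sum_eq_sum_iff_of_le fun v _ => ncard_edgeSet_coPart_add_one_le (h v)]
  simp only [Finset.mem_univ, true_imp_iff, ncard_edgeSet_coPart_add_one_eq_iff (h _)]

theorem totalWeight_le (h : ∀ v, (coPart G H v).coe.IsAcyclic) :
    (totalWeight G H : ℤ) ≤ (∑ᶠ K : MaxClique G, (K.1.ncard : ℤ)) - Nat.card V := by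
  rw [le_sub_iff_add_le, ← Nat.cast_finsum]
  exact_mod_cast totalWeight_add_card_le h

theorem totalWeight_eq_iff (h : ∀ v, (coPart G H v).coe.IsAcyclic) :
    (totalWeight G H : ℤ) = (∑ᶠ K : MaxClique G, (K.1.ncard : ℤ)) - Nat.card V ↔
      ∀ v, (coPart G H v).Connected := by
  rw [eq_sub_iff_add_eq, ← Nat.cast_finsum, ← totalWeight_add_card_eq_iff h]
  exact_mod_cast Iff.rfl

end Weight

end LocChordal

theorem mainTheorem8 {V : Type*} [Finite V] (G : SimpleGraph V) (r : ℕ) (hr : 3 ≤ r)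
    (hG : LocChordal.IsLocallyChordal G r)
    (H : (LocChordal.cliqueIntersectionGraph G).Subgraph) :
    List.TFAE
      [LocChordal.IsAcyclicCliqueGraph G r H,
       LocChordal.IsMaxWeightAcyclicSpanning G 2 H,
       LocChordal.IsAcyclicSpanning G 2 H ∧
        (LocChordal.totalWeight G H : ℤ) =
          (∑ᶠ K : LocChordal.MaxClique G, (K.1.ncard : ℤ)) - (Nat.card V : ℤ)] := by
  have acyclic {T} (hT : LocChordal.IsAcyclicSpanning G 2 T) := hT.isAcyclic_coe_coPart one_le_two
  have spanning {T} (hT : LocChordal.IsAcyclicCliqueGraph G r T) :=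
    hT.isAcyclicSpanning (show 2 ≤ r by omega)
  tfae_have 1 → 3 := fun h =>
    ⟨spanning h, (LocChordal.totalWeight_eq_iff (acyclic (spanning h))).2 h.1.2.connected⟩
  tfae_have 3 → 1 := fun ⟨hH, hw⟩ =>
    hG.isAcyclicCliqueGraph_of_connected hH ((LocChordal.totalWeight_eq_iff (acyclic hH)).1 hw)
  tfae_have 3 → 2 := fun ⟨hH, hw⟩ =>
    ⟨hH, fun T hT => Int.ofNat_le.1 (hw ▸ LocChordal.totalWeight_le (acyclic hT))⟩
  tfae_have 2 → 3 := by
    rintro ⟨hH, hmax⟩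
    obtain ⟨T, hT⟩ := hG.exists_isAcyclicCliqueGraph hr
    refine ⟨hH, (LocChordal.totalWeight_le (acyclic hH)).antisymm ?_⟩
    rw [← (LocChordal.totalWeight_eq_iff (acyclic (spanning hT))).2 hT.1.2.connected]
    exact Int.ofNat_le.2 (hmax T (spanning hT))
  tfae_finish
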